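/- **Fatou's theorem (several variables).** Let $\Omega \subseteq \mathbb{C}^n$ be an open set and let $a, b : \Omega \to \mathbb{C}$ be holomorphic functions with $a(z) \neq b(z)$ for every $z \in \Omega$. Let $\mathcal{F}$ be a family of holomorphic functions $f : \Omega \to \mathbb{C}$ such that $f(z) \neq a(z)$ and $f(z) \neq b(z)$ for all $f \in \mathcal{F}$ and all $z \in \Omega$. Then $\mathcal{F}$ is normal on $\Omega$, that is, every sequence in $\mathcal{F}$ has a subsequence which, on each connected component of $\Omega$, converges uniformly on compact subsets either to a holomorphic function or to $\infty$. -/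

import Mathlib

open Filter Topology

/-- `f j → g` uniformly on every compact subset of `V`, as functions with values in `ℂ`. -/
def ConvergesOnCompacts {n : ℕ} (f : ℕ → EuclideanSpace ℂ (Fin n) → ℂ)
    (g : EuclideanSpace ℂ (Fin n) → ℂ) (V : Set (EuclideanSpace ℂ (Fin n))) : Prop :=
  ∀ K ⊆ V, IsCompact K → TendstoUniformlyOn f g atTop K

/-- `f j → ∞` uniformly on every compact subset of `V`. -/
def DivergesOnCompacts {n : ℕ} (f : ℕ → EuclideanSpace ℂ (Fin n) → ℂ)
    (V : Set (EuclideanSpace ℂ (Fin n))) : Prop :=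
  ∀ K ⊆ V, IsCompact K → ∀ R : ℝ, ∀ᶠ j in atTop, ∀ z ∈ K, R < ‖f j z‖

/-- Normality of a family `F` of holomorphic functions on an open set `Ω ⊆ ℂⁿ`: every sequence in
`F` has a subsequence which, on each connected component of `Ω`, converges uniformly on compact
subsets either to a holomorphic function or to `∞`. If `Ω` is connected, then `Ω` itself is the only
component (none if `Ω` is empty). For open `Ω` this is uniform convergence on the compact subsets
of `Ω` in the spherical metric. -/
def IsNormalFamilyOn {n : ℕ} (F : Set (EuclideanSpace ℂ (Fin n) → ℂ))
    (Ω : Set (EuclideanSpace ℂ (Fin n))) : Prop :=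
  ∀ f : ℕ → EuclideanSpace ℂ (Fin n) → ℂ, (∀ j, f j ∈ F) →
    ∃ φ : ℕ → ℕ, StrictMono φ ∧ ∀ z ∈ Ω,
      (∃ g : EuclideanSpace ℂ (Fin n) → ℂ,
        DifferentiableOn ℂ g (connectedComponentIn Ω z) ∧
        ConvergesOnCompacts (fun j => f (φ j)) g (connectedComponentIn Ω z)) ∨
      DivergesOnCompacts (fun j => f (φ j)) (connectedComponentIn Ω z)

/-!
The functions `(f - a) / (b - a)`, `f ∈ F`, omit the values `0` and `1`, and `f` is recovered from
its quotient by a pointwise affine map whose coefficients are bounded, and whose slope is bounded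
away from zero, on compact sets. So the theorem reduces to Montel's fundamental normality
test for functions omitting `0` and `1`, `exists_subseq_of_omits_zero_one`.

The analytic input is Schottky's theorem (`exists_bound_of_omits_zero_one`): a holomorphic function
on a ball omitting `0` and `1` is bounded on the half ball in terms of a bound at the centre.
Restriction to a complex line reduces it to the unit disc. There `f = exp (2πi u)`, where `u` omits
the integers, and `u = cos w`, where `w` omits the relatively dense set of points at which the
cosine is an integer. The image of `w` therefore contains no large disc, and the theorem of Bloch
and Landau (`norm_deriv_mul_le_of_forall_exists_notMem_image`) bounds `w'`.

Given a sequence, compactness of a countable product of discs yields a subsequence which at each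
point of a countable dense set either converges or tends to infinity. Near every point of `Ω` this
subsequence is then either bounded or divergent to infinity
(`locally_bounded_or_locally_divergent`): Schottky's theorem propagates a bound from a point `d` to
its neighbours, and from a neighbour back to `d`, so that divergence at `d` spreads too, and no
separate argument with Hurwitz's theorem is needed. The two alternatives define disjoint open sets,
so one of them holds on a whole component. In the bounded case the sequence is equicontinuous, hence
converges uniformly on compact sets (`exists_differentiableOn_tendstoUniformlyOn`). As the dense set
meets all components, a single subsequence serves for all of them.
-/

open Metric Set

/-! ### Schottky's theorem -/

open Complex in
/-- A quantitative form of the theorem of Bloch and Landau: a holomorphic function on a disc of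
radius `R` whose image contains no disc of radius `ρ` satisfies `|h'(c)| R ≤ 96 ρ` at the centre. -/
theorem norm_deriv_mul_le_of_forall_exists_notMem_image {h : ℂ → ℂ} {c : ℂ} {R ρ : ℝ} (hR : 0 < R)
    (hd : DifferentiableOn ℂ h (ball c R))
    (hρ : ∀ w, ∃ v ∈ ball w ρ, ∀ z ∈ ball c R, h z ≠ v) :
    ‖deriv h c‖ * R ≤ 96 * ρ := by
  have hd' : DifferentiableOn ℂ (deriv h) (ball c R) := hd.deriv isOpen_ball
  have hsub : closedBall c (R / 2) ⊆ ball c R := closedBall_subset_ball (by linarith)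
  -- The disc in the image is found around `h p`, where `p` maximizes the derivative weighted by
  -- the distance to the boundary; the derivative is then at most doubled near `p`.
  obtain ⟨p, hp, hmax⟩ := (isCompact_closedBall c (R / 2)).exists_isMaxOn
    ⟨c, mem_closedBall_self (by linarith)⟩
    (f := fun z => ‖deriv h z‖ * (R / 2 - dist z c))
    ((hd'.continuousOn.mono hsub).norm.mul (by fun_prop))
  have hc := hmax (mem_closedBall_self (by linarith) : c ∈ closedBall c (R / 2))
  simp only [mem_ofPred_eq, dist_self, sub_zero] at hc
  have hp' : dist p c ≤ R / 2 := hp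
  set A := ‖deriv h p‖ with hA
  set t := (R / 2 - dist p c) / 2 with ht
  by_contra! hcon
  have hρ0 : 0 < ρ := by
    obtain ⟨v, hv, -⟩ := hρ 0
    exact dist_nonneg.trans_lt hv
  have hAt : 24 * ρ < A * t := by rw [ht]; linarith
  have hA0 : 0 ≤ A := norm_nonneg _
  have ht0 : 0 < t := by
    rcases (show 0 ≤ t by rw [ht]; linarith).lt_or_eq with h0 | h0
    · exact h0
    · rw [← h0] at hAt; linarith
  have hA1 : 0 < A := by
    rcases hA0.lt_or_eq with h0 | h0
    · exact h0
    · rw [← h0] at hAt; linarith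
  have hball : ball p t ⊆ ball c R := ball_subset_ball' (by rw [ht]; linarith)
  have hbound : ∀ z ∈ ball p t, ‖deriv h z‖ ≤ 2 * A := by
    intro z hz
    have hz' : dist z p < t := hz
    have h1 : dist z c ≤ dist z p + dist p c := dist_triangle _ _ _
    have h2 : ‖deriv h z‖ * (R / 2 - dist z c) ≤ A * (R / 2 - dist p c) :=
      hmax (show z ∈ closedBall c (R / 2) from mem_closedBall.2 (by rw [ht] at hz'; linarith))
    have h3 : t ≤ R / 2 - dist z c := by rw [ht] at hz' ⊢; linarith
    have h4 : ‖deriv h z‖ * t ≤ 2 * A * t :=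
      (mul_le_mul_of_nonneg_left h3 (norm_nonneg _)).trans (by rw [ht]; linarith)
    exact le_of_mul_le_mul_right h4 ht0
  have hmaps : MapsTo (deriv h) (ball p t) (closedBall (deriv h p) (3 * A)) := by
    intro z hz
    rw [mem_closedBall, dist_eq_norm]
    exact (norm_sub_le _ _).trans (by linarith [hbound z hz])
  have hsmall : closedBall p (t / 6) ⊆ ball p t := closedBall_subset_ball (by linarith)
  have hlip : ∀ z ∈ closedBall p (t / 6), ‖deriv h z - deriv h p‖ ≤ A / 2 := by
    intro z hz
    have := dist_le_div_mul_dist_of_mapsTo_ball (hd'.mono hball) hmaps (hsmall hz)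
    rw [dist_eq_norm] at this
    calc _ ≤ 3 * A / t * dist z p := this
      _ ≤ 3 * A / t * (t / 6) := by gcongr; exact hz
      _ = A / 2 := by field_simp; norm_num
  have hsphere : ∀ z ∈ sphere p (t / 6), A * t / 12 ≤ ‖h z - h p‖ := by
    intro z hz
    have hz1 : ‖z - p‖ = t / 6 := by rw [← dist_eq_norm]; exact hz
    have hda : ∀ x ∈ closedBall p (t / 6), DifferentiableAt ℂ h x := fun x hx =>
      hd.differentiableAt (isOpen_ball.mem_nhds (hball (hsmall hx)))
    have key : ‖(h z - z * deriv h p) - (h p - p * deriv h p)‖ ≤ A / 2 * ‖z - p‖ := by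
      refine (convex_closedBall p (t / 6)).norm_image_sub_le_of_norm_hasDerivWithin_le
        (f := fun x => h x - x * deriv h p) (f' := fun x => deriv h x - deriv h p) ?_ hlip
        (mem_closedBall_self (by linarith)) (sphere_subset_closedBall hz)
      intro x hx
      have := ((hda x hx).hasDerivAt.sub ((hasDerivAt_id x).mul_const (deriv h p)))
      rw [one_mul] at this
      exact this.hasDerivWithinAt
    have e : (z - p) * deriv h p
        = (h z - h p) - ((h z - z * deriv h p) - (h p - p * deriv h p)) := by ring
    have e2 : ‖(z - p) * deriv h p‖ ≤ ‖h z - h p‖ + A / 2 * ‖z - p‖ := by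
      rw [e]; exact (norm_sub_le _ _).trans (by linarith)
    rw [norm_mul, hz1, ← hA] at e2
    nlinarith
  have hdc : DiffContOnCl ℂ h (ball p (t / 6)) :=
    (hd.mono (hsmall.trans hball)).diffContOnCl_ball subset_rfl
  have hne : ∃ᶠ z in 𝓝 p, h z ≠ h p := by
    have hpR : p ∈ ball c R := hball (mem_ball_self ht0)
    have := (hd.differentiableAt (isOpen_ball.mem_nhds hpR)).hasDerivAt.eventually_ne
      (c := h p) (norm_pos_iff.1 hA1)
    exact this.frequently.filter_mono nhdsWithin_le_nhds
  obtain ⟨v, hv, hv'⟩ := hρ (h p)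
  obtain ⟨z, hz, rfl⟩ := hdc.ball_subset_image_closedBall (by linarith) hsphere hne
    (ball_subset_ball (by linarith) hv)
  exact hv' z (hball (hsmall hz)) rfl

/-- A zero-free holomorphic function on a disc has a holomorphic logarithm, which takes the
principal value at the centre. -/
theorem exists_differentiableOn_exp_eq {f : ℂ → ℂ} {c : ℂ} {R : ℝ} (hR : 0 < R)
    (hf : DifferentiableOn ℂ f (ball c R)) (h0 : ∀ z ∈ ball c R, f z ≠ 0) :
    ∃ L : ℂ → ℂ, DifferentiableOn ℂ L (ball c R) ∧ (∀ z ∈ ball c R, Complex.exp (L z) = f z) ∧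
      L c = Complex.log (f c) := by
  have hc : c ∈ ball c R := mem_ball_self hR
  obtain ⟨L, hL0, hL⟩ := (((hf.deriv isOpen_ball).div hf h0).isExactOn_ball).with_val_at c
    (Complex.log (f c))
  refine ⟨L, fun z hz => (hL z hz).differentiableAt.differentiableWithinAt, fun z hz => ?_, hL0⟩
  have hder : ∀ x ∈ ball c R, HasDerivAt (fun x => f x * Complex.exp (-L x)) 0 x := by
    intro x hx
    have h1 := (hf.differentiableAt (isOpen_ball.mem_nhds hx)).hasDerivAt.mul (hL x hx).neg.cexp
    have h2 : deriv f x * Complex.exp ((-L) x)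
        + f x * (Complex.exp ((-L) x) * -(deriv f / f) x) = 0 := by
      have := h0 x hx
      rw [Pi.div_apply]
      field_simp
      ring
    rw [h2] at h1
    exact h1
  have hconst := isOpen_ball.is_const_of_deriv_eq_zero (convex_ball c R).isPreconnected
    (fun x hx => (hder x hx).differentiableAt.differentiableWithinAt)
    (fun x hx => (hder x hx).deriv) hz hc
  simp only [hL0, Complex.exp_neg, Complex.exp_log (h0 c hc), mul_inv_cancel₀ (h0 c hc)] at hconst
  field_simp [Complex.exp_ne_zero] at hconst
  exact hconst.symm

theorem Complex.norm_log_le (z : ℂ) : ‖Complex.log z‖ ≤ |Real.log ‖z‖| + Real.pi := by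
  refine (Complex.norm_le_abs_re_add_abs_im _).trans ?_
  rw [Complex.log_re, Complex.log_im]
  gcongr
  exact Complex.abs_arg_le_pi z

/-- A holomorphic function on a disc omitting `1` and `-1` is the cosine of a holomorphic
function whose value at the centre is controlled. -/
theorem exists_differentiableOn_cos_eq {u : ℂ → ℂ} {c : ℂ} {R : ℝ} (hR : 0 < R)
    (hu : DifferentiableOn ℂ u (ball c R)) (h1 : ∀ z ∈ ball c R, u z ≠ 1)
    (h2 : ∀ z ∈ ball c R, u z ≠ -1) :
    ∃ w : ℂ → ℂ, DifferentiableOn ℂ w (ball c R) ∧ (∀ z ∈ ball c R, Complex.cos (w z) = u z) ∧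
      ‖w c‖ ≤ 2 * ‖u c‖ + Real.pi := by
  have hc : c ∈ ball c R := mem_ball_self hR
  obtain ⟨L, hLd, hL, -⟩ := exists_differentiableOn_exp_eq hR (f := fun z => 1 - u z ^ 2)
    (by fun_prop) (fun z hz h => by
      have : (1 - u z) * (1 + u z) = 0 := by linear_combination h
      rcases mul_eq_zero.1 this with h | h
      · exact h1 z hz (by linear_combination -h)
      · exact h2 z hz (by linear_combination h))
  -- `s` is a branch of `√(1 - u²)`, so that `q = u + i s` has inverse `u - i s`.
  set s : ℂ → ℂ := fun z => Complex.exp (L z / 2) with hs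
  have hsq : ∀ z ∈ ball c R, s z ^ 2 = 1 - u z ^ 2 := by
    intro z hz
    rw [← hL z hz, hs, ← Complex.exp_nat_mul]
    congr 1
    push_cast
    ring
  have hq : ∀ z ∈ ball c R, (u z + Complex.I * s z) * (u z - Complex.I * s z) = 1 := by
    intro z hz
    linear_combination hsq z hz - s z ^ 2 * Complex.I_sq
  have hq0 : ∀ z ∈ ball c R, u z + Complex.I * s z ≠ 0 := fun z hz =>
    left_ne_zero_of_mul_eq_one (hq z hz)
  obtain ⟨W, hWd, hW, hWc⟩ := exists_differentiableOn_exp_eq hR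
    (f := fun z => u z + Complex.I * s z) (by fun_prop) hq0
  refine ⟨fun z => -Complex.I * W z, by fun_prop, fun z hz => ?_, ?_⟩
  · have e1 : -Complex.I * W z * Complex.I = W z := by
      linear_combination -W z * Complex.I_sq
    rw [Complex.cos, neg_mul, e1, Complex.exp_neg, hW z hz,
      ← eq_inv_of_mul_eq_one_right (hq z hz)]
    ring
  · have hB : ∀ ε : ℂ, ‖ε‖ = 1 → ‖u c + ε * s c‖ ≤ 1 + 2 * ‖u c‖ := by
      intro ε hε
      have h3 : ‖s c‖ ^ 2 ≤ 1 + ‖u c‖ ^ 2 := by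
        rw [← norm_pow, hsq c hc]
        exact (norm_sub_le _ _).trans (by simp)
      have h4 : ‖s c‖ ≤ 1 + ‖u c‖ :=
        abs_le_of_sq_le_sq' (by nlinarith [norm_nonneg (u c)]) (by positivity) |>.2
      calc _ ≤ ‖u c‖ + ‖ε * s c‖ := norm_add_le _ _
        _ ≤ 1 + 2 * ‖u c‖ := by rw [norm_mul, hε]; linarith
    have hB1 := hB Complex.I (by simp)
    have hB2 := hB (-Complex.I) (by simp)
    rw [neg_mul, ← sub_eq_add_neg, eq_inv_of_mul_eq_one_right (hq c hc), norm_inv] at hB2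
    have hpos : 0 < ‖u c + Complex.I * s c‖ := norm_pos_iff.2 (hq0 c hc)
    have hl1 := Real.log_le_sub_one_of_pos hpos
    have hl2 := Real.log_le_sub_one_of_pos (inv_pos.2 hpos)
    rw [Real.log_inv] at hl2
    have : ‖-Complex.I * W c‖ = ‖W c‖ := by simp
    rw [this, hWc]
    refine (Complex.norm_log_le _).trans ?_
    gcongr
    exact abs_le.2 ⟨by linarith, by linarith⟩

/-- The points where the cosine is an integer are relatively dense in the plane. -/
theorem exists_mem_ball_cos_eq_intCast (w : ℂ) :
    ∃ v ∈ ball w 6, ∃ n : ℤ, Complex.cos v = n := by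
  have aux : ∀ y : ℝ, 0 ≤ y → ∃ t ∈ Icc y (y + 2), ∃ n : ℤ, Real.cosh t = n := by
    intro y hy
    have h1 : (⌈Real.cosh y⌉ : ℝ) ∈ Icc (Real.cosh y) (Real.cosh (y + 2)) := by
      refine ⟨Int.le_ceil _, (Int.ceil_lt_add_one _).le.trans ?_⟩
      rw [Real.cosh_add]
      have hc2 : 2 ≤ Real.cosh 2 := by
        have h1 := Real.add_one_le_exp 1
        have h2 : Real.exp 2 = Real.exp 1 * Real.exp 1 := by rw [← Real.exp_add]; norm_num
        rw [Real.cosh_eq]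
        nlinarith [Real.exp_pos (-2)]
      have hs2 : 0 ≤ Real.sinh 2 := Real.sinh_nonneg_iff.2 (by norm_num)
      have hs : 0 ≤ Real.sinh y := Real.sinh_nonneg_iff.2 hy
      nlinarith [Real.one_le_cosh y, mul_nonneg hs hs2]
    obtain ⟨t, ht, he⟩ := intermediate_value_Icc (by linarith) Real.continuous_cosh.continuousOn h1
    exact ⟨t, ht, _, he⟩
  have aux' : ∀ y : ℝ, ∃ t : ℝ, |t - y| ≤ 2 ∧ ∃ n : ℤ, Real.cosh t = n := by
    intro y
    rcases le_total 0 y with hy | hy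
    · obtain ⟨t, ht, hn⟩ := aux y hy
      exact ⟨t, abs_le.2 ⟨by linarith [ht.1], by linarith [ht.2]⟩, hn⟩
    · obtain ⟨t, ht, hn⟩ := aux (-y) (by linarith)
      exact ⟨-t, abs_le.2 ⟨by linarith [ht.2], by linarith [ht.1]⟩, by rwa [Real.cosh_neg]⟩
  -- `w` lies within `π` of a line `Re = 2πk`, on which `cos (2πk + it) = cosh t`.
  obtain ⟨t, ht, n, hn⟩ := aux' w.im
  set k : ℤ := round (w.re / (2 * Real.pi)) with hk
  have hk' := abs_sub_round (w.re / (2 * Real.pi))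
  have hre : |k * (2 * Real.pi) - w.re| ≤ Real.pi := by
    have e : (k : ℝ) * (2 * Real.pi) - w.re = -(w.re / (2 * Real.pi) - k) * (2 * Real.pi) := by
      field_simp
      ring
    rw [e, abs_mul, abs_neg, abs_of_pos Real.two_pi_pos]
    nlinarith [Real.pi_pos]
  refine ⟨t * Complex.I + k * (2 * Real.pi), ?_, n, ?_⟩
  · rw [mem_ball, dist_eq_norm]
    refine (Complex.norm_le_abs_re_add_abs_im _).trans_lt ?_
    have e1 : ((t : ℂ) * Complex.I + k * (2 * Real.pi) - w).re = k * (2 * Real.pi) - w.re := by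
      simp
    have e2 : ((t : ℂ) * Complex.I + k * (2 * Real.pi) - w).im = t - w.im := by
      simp
    rw [e1, e2]
    linarith [Real.pi_lt_four]
  · rw [Complex.cos_add_int_mul_two_pi, Complex.cos_mul_I, ← Complex.ofReal_cosh, hn]
    simp

theorem Complex.norm_cos_le_exp_norm (w : ℂ) : ‖Complex.cos w‖ ≤ Real.exp ‖w‖ := by
  rw [Complex.cos, norm_div]
  have h1 := Complex.norm_exp_le_exp_norm (w * Complex.I)
  have h2 := Complex.norm_exp_le_exp_norm (-w * Complex.I)
  simp only [norm_mul, norm_neg, Complex.norm_I, mul_one] at h1 h2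
  have h3 := norm_add_le (Complex.exp (w * Complex.I)) (Complex.exp (-w * Complex.I))
  simp only [Complex.norm_ofNat]
  linarith

/-- Schottky's theorem on the unit disc when the value at the centre is not small. The double
logarithm `w`, with `f = exp (2πi cos w)`, omits every point at which the cosine is an integer, so
the Bloch–Landau estimate bounds its derivative. -/
theorem exists_bound_of_half_le_norm (M : ℝ) : ∃ C : ℝ, ∀ f : ℂ → ℂ,
    DifferentiableOn ℂ f (ball 0 1) → (∀ z ∈ ball (0 : ℂ) 1, f z ≠ 0 ∧ f z ≠ 1) →
    1 / 2 ≤ ‖f 0‖ → ‖f 0‖ ≤ M → ∀ z ∈ closedBall (0 : ℂ) (1 / 2), ‖f z‖ ≤ C := by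
  refine ⟨Real.exp (2 * Real.pi *
    Real.exp (2 * (M + 2 + Real.pi) + Real.pi + 96 * 6 * 2 * (1 / 2))), ?_⟩
  intro f hf h01 hlow hM z hz
  have hzero : (0 : ℂ) ∈ ball (0 : ℂ) 1 := by simp
  have hpi2 : (2 * Real.pi * Complex.I : ℂ) ≠ 0 := Complex.two_pi_I_ne_zero
  obtain ⟨L, hLd, hL, hL0⟩ :=
    exists_differentiableOn_exp_eq one_pos hf (fun z hz => (h01 z hz).1)
  set u : ℂ → ℂ := fun z => L z / (2 * Real.pi * Complex.I) with hu
  have hfu : ∀ z ∈ ball (0 : ℂ) 1, f z = Complex.exp (u z * (2 * Real.pi * Complex.I)) := by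
    intro z hz
    rw [hu, ← hL z hz]
    congr 1
    field_simp
  have hint : ∀ z ∈ ball (0 : ℂ) 1, ∀ n : ℤ, u z ≠ n := by
    intro z hz n hn
    apply (h01 z hz).2
    rw [hfu z hz, hn, Complex.exp_int_mul_two_pi_mul_I]
  obtain ⟨w, hwd, hw, hw0⟩ := exists_differentiableOn_cos_eq one_pos (u := u) (by fun_prop)
    (fun z hz => by simpa using hint z hz 1) (fun z hz => by simpa using hint z hz (-1))
  have hu0 : ‖u 0‖ ≤ M + 2 + Real.pi := by
    have h1 : ‖u 0‖ ≤ ‖L 0‖ := by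
      rw [hu]
      simp only [norm_div, norm_mul, Complex.norm_ofNat, Complex.norm_real, Complex.norm_I, mul_one]
      refine div_le_self (norm_nonneg _) ?_
      rw [Real.norm_of_nonneg Real.pi_pos.le]
      linarith [Real.pi_gt_three]
    refine h1.trans ?_
    rw [hL0]
    refine (Complex.norm_log_le _).trans ?_
    have hpos : 0 < ‖f 0‖ := by linarith
    have hl1 := Real.log_le_sub_one_of_pos hpos
    have hl2 := Real.log_le_sub_one_of_pos (inv_pos.2 hpos)
    rw [Real.log_inv] at hl2
    have h3 : ‖f 0‖⁻¹ ≤ 2 := by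
      rw [inv_le_comm₀ hpos two_pos]; linarith
    gcongr
    exact abs_le.2 ⟨by linarith, by linarith⟩
  have hderiv : ∀ x ∈ closedBall (0 : ℂ) (1 / 2), ‖deriv w x‖ ≤ 96 * 6 * 2 := by
    intro x hx
    have hsub : ball x (1 / 2) ⊆ ball (0 : ℂ) 1 :=
      ball_subset_ball' (by rw [mem_closedBall] at hx; linarith)
    have := norm_deriv_mul_le_of_forall_exists_notMem_image (h := w) (c := x) (ρ := 6) one_half_pos
      (hwd.mono hsub) (fun a => by
        obtain ⟨v, hv, n, hn⟩ := exists_mem_ball_cos_eq_intCast a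
        refine ⟨v, hv, fun y hy hyv => hint y (hsub hy) n ?_⟩
        rw [← hw y (hsub hy), hyv, hn])
    linarith
  have hsub1 : closedBall (0 : ℂ) (1 / 2) ⊆ ball 0 1 := closedBall_subset_ball (by norm_num)
  have hwz : ‖w z - w 0‖ ≤ 96 * 6 * 2 * ‖z - 0‖ :=
    (convex_closedBall (0 : ℂ) (1 / 2)).norm_image_sub_le_of_norm_deriv_le
      (fun x hx => hwd.differentiableAt (isOpen_ball.mem_nhds (hsub1 hx))) hderiv
      (mem_closedBall_self (by norm_num)) hz
  have hz' : ‖z - 0‖ ≤ 1 / 2 := by rw [← dist_eq_norm]; exact hz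
  have hwz2 : ‖w z‖ ≤ 2 * (M + 2 + Real.pi) + Real.pi + 96 * 6 * 2 * (1 / 2) := by
    have := norm_le_norm_add_norm_sub (w 0) (w z)
    rw [norm_sub_rev] at this
    linarith
  rw [hfu z (hsub1 hz)]
  refine (Complex.norm_exp_le_exp_norm _).trans (Real.exp_le_exp.2 ?_)
  rw [← hw z (hsub1 hz)]
  simp only [norm_mul, Complex.norm_ofNat, Complex.norm_real, Complex.norm_I, mul_one]
  rw [Real.norm_of_nonneg Real.pi_pos.le, mul_comm]
  gcongr
  exact (Complex.norm_cos_le_exp_norm _).trans (Real.exp_le_exp.2 hwz2)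

/-- **Schottky's theorem** on balls of complex normed spaces. -/
theorem exists_bound_of_omits_zero_one (M : ℝ) {E : Type*} [NormedAddCommGroup E]
    [NormedSpace ℂ E] : ∃ C : ℝ, ∀ (f : E → ℂ) (c : E) (R : ℝ),
    DifferentiableOn ℂ f (ball c R) → (∀ z ∈ ball c R, f z ≠ 0 ∧ f z ≠ 1) →
    ‖f c‖ ≤ M → ∀ z ∈ ball c (R / 2), ‖f z‖ ≤ C := by
  obtain ⟨C, hC⟩ := exists_bound_of_half_le_norm (M + 1)
  refine ⟨C + 1, fun f c R hf h01 hM z hz => ?_⟩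
  rw [mem_ball, dist_eq_norm] at hz
  set v : E := (2 : ℂ) • (z - c) with hv
  have hvn : ‖v‖ < R := by rw [hv, norm_smul, Complex.norm_ofNat]; linarith
  have hmaps : MapsTo (fun ζ : ℂ => c + ζ • v) (ball 0 1) (ball c R) := by
    intro ζ hζ
    rw [mem_ball_zero_iff] at hζ
    rw [mem_ball, dist_eq_norm, add_sub_cancel_left, norm_smul]
    exact (mul_le_of_le_one_left (norm_nonneg _) hζ.le).trans_lt hvn
  have hFd : DifferentiableOn ℂ (fun ζ : ℂ => f (c + ζ • v)) (ball 0 1) :=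
    hf.comp (by fun_prop) hmaps
  have hz2 : c + (1 / 2 : ℂ) • v = z := by
    rw [hv, smul_smul]; norm_num
  have hmem : (1 / 2 : ℂ) ∈ closedBall (0 : ℂ) (1 / 2) := by simp
  -- If `f c` is small, Schottky's theorem is applied to `1 - f` instead.
  rcases le_total (1 / 2) ‖f c‖ with hlow | hlow
  · have := hC (fun ζ : ℂ => f (c + ζ • v)) hFd (fun ζ hζ => h01 _ (hmaps hζ))
      (by simpa using hlow) (by simpa using hM.trans (by linarith)) _ hmem
    simp only [hz2] at this
    linarith
  · have h1 := norm_sub_norm_le 1 (f c)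
    have h2 := norm_sub_le 1 (f c)
    rw [norm_one] at h1 h2
    have := hC (fun ζ : ℂ => 1 - f (c + ζ • v)) (by fun_prop)
      (fun ζ hζ => ⟨fun h => (h01 _ (hmaps hζ)).2 (by linear_combination -h),
        fun h => (h01 _ (hmaps hζ)).1 (by linear_combination -h)⟩)
      (by simpa using (by linarith : 1 / 2 ≤ ‖1 - f c‖))
      (by simpa using (by linarith : ‖1 - f c‖ ≤ M + 1)) _ hmem
    simp only [hz2] at this
    have h3 := norm_sub_norm_le (f z) 1
    rw [norm_one, norm_sub_rev] at h3
    linarith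

/-! ### Subsequences and divergence -/

/-- A sequence of functions on a countable set has a subsequence that at each point converges in
`ℂ` or tends to infinity. -/
theorem exists_subseq_tendsto_or_tendsto_norm_atTop {D : Type*} [Countable D] (u : ℕ → D → ℂ) :
    ∃ φ : ℕ → ℕ, StrictMono φ ∧ ∀ d, (∃ l, Tendsto (fun j => u (φ j) d) atTop (𝓝 l)) ∨
      Tendsto (fun j => ‖u (φ j) d‖) atTop atTop := by
  -- The plane is embedded in the compact unit disc by `z ↦ z / (1 + |z|)`.
  set T : ℂ → ℂ := fun z => z / (1 + ‖z‖ : ℝ) with hT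
  have hTn : ∀ z, ‖T z‖ = ‖z‖ / (1 + ‖z‖) := fun z => by
    rw [hT]
    simp only [norm_div, Complex.norm_real]
    rw [Real.norm_of_nonneg (by positivity)]
  have hTn' : ∀ z, (1 - ‖T z‖) * (1 + ‖z‖) = 1 := fun z => by
    have : 1 + ‖z‖ ≠ 0 := by positivity
    rw [hTn]
    field_simp
    ring
  have hle : ∀ z, ‖T z‖ ≤ 1 := fun z => by
    by_contra! h
    have := hTn' z
    nlinarith [norm_nonneg z]
  obtain ⟨a, ha, φ, hφ, hlim⟩ :=
    (isCompact_univ_pi fun _ : D => isCompact_closedBall (0 : ℂ) 1).tendsto_subseq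
      (x := fun j d => T (u j d)) (fun j d _ => by simpa using hle (u j d))
  rw [tendsto_pi_nhds] at hlim
  refine ⟨φ, hφ, fun d => ?_⟩
  have hd : Tendsto (fun j => T (u (φ j) d)) atTop (𝓝 (a d)) := hlim d
  have had : ‖a d‖ ≤ 1 := by simpa using ha d (mem_univ d)
  have hsub : Tendsto (fun j => 1 - ‖T (u (φ j) d)‖) atTop (𝓝 (1 - ‖a d‖)) :=
    tendsto_const_nhds.sub hd.norm
  have hinv : ∀ z, (1 - ‖T z‖)⁻¹ = 1 + ‖z‖ := fun z => 
    inv_eq_of_mul_eq_one_right (hTn' z)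
  rcases had.lt_or_eq with hlt | heq
  · left
    refine ⟨a d * ((1 - ‖a d‖ : ℝ) : ℂ)⁻¹, ?_⟩
    have h1 := hd.mul (((Complex.continuous_ofReal.tendsto _).comp hsub).inv₀
      (Complex.ofReal_ne_zero.2 (by linarith : 1 - ‖a d‖ ≠ 0 )))
    refine h1.congr fun j => ?_
    have : ((1 + ‖u (φ j) d‖ : ℝ) : ℂ) ≠ 0 := Complex.ofReal_ne_zero.2 (by positivity)
    simp only [Function.comp_apply]
    rw [← Complex.ofReal_inv, hinv, hT]
    field_simp
  · right
    have h1 : Tendsto (fun j => 1 - ‖T (u (φ j) d)‖) atTop (𝓝[>] 0) := by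
      rw [heq, sub_self] at hsub
      refine tendsto_nhdsWithin_iff.2 ⟨hsub, Eventually.of_forall fun j => ?_⟩
      rw [mem_Ioi, ← inv_pos, hinv]
      positivity
    refine (tendsto_atTop_add_const_left atTop (-1) h1.inv_tendsto_nhdsGT_zero).congr fun j => ?_
    rw [Pi.inv_apply, hinv]
    ring

/-- A sequence that diverges locally uniformly diverges uniformly on compact sets. -/
theorem eventually_lt_norm_of_isCompact {E : Type*} [PseudoMetricSpace E] {g : ℕ → E → ℂ}
    {K : Set E} (hK : IsCompact K)
    (h : ∀ z ∈ K, ∃ r > 0, ∀ M : ℝ, ∀ᶠ j in atTop, ∀ x ∈ ball z r, M < ‖g j x‖) (M : ℝ) :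
    ∀ᶠ j in atTop, ∀ z ∈ K, M < ‖g j z‖ := by
  choose! r hr hM using h
  obtain ⟨t, htK, ht⟩ := hK.elim_nhds_subcover (fun z => ball z (r z))
    (fun z hz => ball_mem_nhds z (hr z hz))
  filter_upwards [(eventually_all_finset t).2 fun z hz => hM z (htK z hz) M] with j hj x hx
  obtain ⟨z, hz, hxz⟩ := mem_iUnion₂.1 (ht hx)
  exact hj z hz x hxz

/-! ### Sequences of holomorphic functions of several variables -/

section

variable {E : Type*} [NormedAddCommGroup E] [NormedSpace ℂ E]

/-- A uniform limit of holomorphic functions on a ball of a complex normed space is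
holomorphic: by the Schwarz lemma, the derivatives converge uniformly as well. -/
theorem differentiableAt_of_tendstoUniformlyOn_ball {g : ℕ → E → ℂ} {G : E → ℂ} {z : E} {r : ℝ}
    (hr : 0 < r) (hg : ∀ j, DifferentiableOn ℂ (g j) (ball z r))
    (hlim : TendstoUniformlyOn g G atTop (ball z r)) : DifferentiableAt ℂ G z := by
  have hsub : ∀ x ∈ ball z (r / 2), ball x (r / 2) ⊆ ball z r := fun x hx =>
    ball_subset_ball' (by rw [mem_ball] at hx; linarith)
  have hda : ∀ j, ∀ x ∈ ball z (r / 2), DifferentiableAt ℂ (g j) x := fun j x hx =>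
    (hg j).differentiableAt (isOpen_ball.mem_nhds (hsub x hx (mem_ball_self (by linarith))))
  have hC : UniformCauchySeqOn (fun j => fderiv ℂ (g j)) atTop (ball z (r / 2)) := by
    rw [Metric.uniformCauchySeqOn_iff]
    intro ε hε
    obtain ⟨N, hN⟩ := Metric.uniformCauchySeqOn_iff.1 hlim.uniformCauchySeqOn
      (ε * r / 8) (by positivity)
    refine ⟨N, fun m hm n hn x hx => ?_⟩
    rw [dist_eq_norm, ← fderiv_sub (hda m x hx) (hda n x hx)]
    have hsmall : ∀ y ∈ ball x (r / 2), ‖(g m - g n) y‖ ≤ ε * r / 8 := fun y hy => by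
      have := hN m hm n hn y (hsub x hx hy)
      rw [dist_eq_norm] at this
      exact this.le
    have := Complex.norm_fderiv_le_div_of_mapsTo_ball (f := g m - g n) (c := x) (R₁ := r / 2)
      (R₂ := ε * r / 4) (((hg m).sub (hg n)).mono (hsub x hx)) (fun y hy => by
        rw [mem_closedBall, dist_eq_norm]
        refine (norm_sub_le _ _).trans ?_
        linarith [hsmall y hy, hsmall x (mem_ball_self (by linarith))]) (by linarith)
    refine this.trans_lt ?_
    rw [div_lt_iff₀ (by linarith)]
    nlinarith [mul_pos hε hr]
  choose! G' hG' using fun x (hx : x ∈ ball z (r / 2)) =>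
    cauchySeq_tendsto_of_complete (hC.cauchySeq hx)
  have hU := hC.tendstoUniformlyOn_of_tendsto hG'
  refine (hasFDerivAt_of_tendstoUniformlyOn isOpen_ball hU
    (fun j x hx => (hda j x hx).hasFDerivAt) (fun x hx => ?_)
    (mem_ball_self (half_pos hr))).differentiableAt
  exact hlim.tendsto_at (hsub x hx (mem_ball_self (by linarith)))

/-- Locally bounded sequences of holomorphic functions are equicontinuous. -/
theorem equicontinuousAt_of_norm_le {ι : Type*} {g : ι → E → ℂ} {z : E} {r M : ℝ} (hr : 0 < r)
    (hg : ∀ j, DifferentiableOn ℂ (g j) (ball z r)) (hM : ∀ j, ∀ x ∈ ball z r, ‖g j x‖ ≤ M) :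
    EquicontinuousAt g z := by
  refine Metric.equicontinuousAt_of_continuity_modulus (fun x => 2 * M / r * dist x z) ?_ g ?_
  · have : Tendsto (fun x => 2 * M / r * dist x z) (𝓝 z) (𝓝 (2 * M / r * dist z z)) :=
      Continuous.tendsto (by fun_prop) z
    simpa using this
  · filter_upwards [ball_mem_nhds z hr] with x hx j
    rw [dist_comm]
    refine Complex.dist_le_div_mul_dist_of_mapsTo_ball (hg j) (fun y hy => ?_) hx
    rw [mem_closedBall, dist_eq_norm]
    refine (norm_sub_le _ _).trans ?_
    linarith [hM j y hy, hM j z (mem_ball_self hr)]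

/-- A case of the **Vitali–Porter theorem**: a locally bounded sequence of holomorphic functions on
an open set that converges at the points of a dense set converges uniformly on compact sets, to
a holomorphic function. -/
theorem exists_differentiableOn_tendstoUniformlyOn [ProperSpace E] {g : ℕ → E → ℂ} {V D : Set E}
    (hV : IsOpen V) (hD : Dense D) (hg : ∀ j, DifferentiableOn ℂ (g j) V)
    (hbdd : ∀ z ∈ V, ∃ r > 0, ∃ M, ∀ j, ∀ x ∈ ball z r, ‖g j x‖ ≤ M)
    (hlim : ∀ d ∈ D ∩ V, ∃ l, Tendsto (fun j => g j d) atTop (𝓝 l)) :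
    ∃ G : E → ℂ, DifferentiableOn ℂ G V ∧
      ∀ K ⊆ V, IsCompact K → TendstoUniformlyOn g G atTop K := by
  have heq : ∀ z ∈ V, EquicontinuousAt g z := by
    intro z hz
    obtain ⟨r, hr, M, hM⟩ := hbdd z hz
    obtain ⟨s, hs, hsV⟩ := Metric.isOpen_iff.1 hV z hz
    exact equicontinuousAt_of_norm_le (lt_min hr hs)
      (fun j => (hg j).mono ((ball_subset_ball (min_le_right r s)).trans hsV))
      (fun j x hx => hM j x (ball_subset_ball (min_le_left r s) hx))
  have hpt : ∀ z ∈ V, ∃ l, Tendsto (fun j => g j z) atTop (𝓝 l) := by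
    intro z hz
    refine cauchySeq_tendsto_of_complete (Metric.cauchySeq_iff.2 fun ε hε => ?_)
    obtain ⟨δ, hδ, hclose⟩ := Metric.equicontinuousAt_iff.1 (heq z hz) (ε / 3) (by positivity)
    obtain ⟨s, hs, hsV⟩ := Metric.isOpen_iff.1 hV z hz
    obtain ⟨d, hdD, hd⟩ := hD.exists_dist_lt z (lt_min hδ hs)
    rw [dist_comm] at hd
    obtain ⟨l, hl⟩ := hlim d ⟨hdD, hsV (hd.trans_le (min_le_right _ _))⟩
    obtain ⟨N, hN⟩ := Metric.cauchySeq_iff.1 hl.cauchySeq (ε / 3) (by positivity)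
    refine ⟨N, fun m hm n hn => ?_⟩
    have h1 := hclose d (hd.trans_le (min_le_left _ _)) m
    have h2 := hclose d (hd.trans_le (min_le_left _ _)) n
    have h3 := hN m hm n hn
    linarith [dist_triangle4 (g m z) (g m d) (g n d) (g n z), dist_comm (g n d) (g n z)]
  choose! G hG using hpt
  have hK : ∀ K ⊆ V, IsCompact K → TendstoUniformlyOn g G atTop K := by
    intro K hKV hK
    have h1 := (EquicontinuousOn.tendsto_uniformOnFun_iff_pi' (𝔖 := {K}) (F := g)
      (by simpa using hK)
      (fun K' hK' x hx => (heq x (hKV (by rwa [mem_singleton_iff.1 hK'] at hx))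
        ).equicontinuousWithinAt K') atTop G).2 (by
      rw [tendsto_pi_nhds]
      rintro ⟨x, hx⟩
      exact hG x (hKV (by simpa using hx)))
    exact UniformOnFun.tendsto_iff_tendstoUniformlyOn.1 h1 K (mem_singleton K)
  refine ⟨G, fun z hz => ?_, hK⟩
  obtain ⟨r, hr, hrV⟩ := Metric.nhds_basis_closedBall.mem_iff.1 (hV.mem_nhds hz)
  exact (differentiableAt_of_tendstoUniformlyOn_ball hr
    (fun j => (hg j).mono (ball_subset_closedBall.trans hrV))
    ((hK _ hrV (isCompact_closedBall z r)).mono ball_subset_closedBall)).differentiableWithinAt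

/-- Schottky's theorem, applied from `d` to nearby points and from nearby points to `d`, spreads
the behaviour of a sequence at `d` to a neighbourhood. -/
theorem locally_bounded_or_locally_divergent {g : ℕ → E → ℂ} {Ω D : Set E} (hΩ : IsOpen Ω)
    (hD : Dense D) (hg : ∀ j, DifferentiableOn ℂ (g j) Ω)
    (h01 : ∀ j, ∀ z ∈ Ω, g j z ≠ 0 ∧ g j z ≠ 1)
    (hlim : ∀ d ∈ D, (∃ l, Tendsto (fun j => g j d) atTop (𝓝 l)) ∨
      Tendsto (fun j => ‖g j d‖) atTop atTop) {z : E} (hz : z ∈ Ω) :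
    (∃ r > 0, ∃ M, ∀ j, ∀ x ∈ ball z r, ‖g j x‖ ≤ M) ∨
      ∃ r > 0, ∀ M, ∀ᶠ j in atTop, ∀ x ∈ ball z r, M < ‖g j x‖ := by
  obtain ⟨R, hR, hball⟩ := Metric.isOpen_iff.1 hΩ z hz
  obtain ⟨d, hdD, hd⟩ := hD.exists_dist_lt z (by positivity : 0 < R / 8)
  rw [dist_comm] at hd
  have hsub : ∀ x, dist x z < R / 8 → ball x (R / 2) ⊆ Ω := fun x hx =>
    (ball_subset_ball' (by linarith)).trans hball
  rcases hlim d hdD with ⟨l, hl⟩ | hinf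
  · left
    obtain ⟨M, hM⟩ := isBounded_iff_forall_norm_le.1 (isBounded_range_of_tendsto _ hl)
    obtain ⟨C, hC⟩ := exists_bound_of_omits_zero_one M (E := E)
    refine ⟨R / 8, by positivity, C, fun j x hx => ?_⟩
    refine hC (g j) d (R / 2) ((hg j).mono (hsub d hd)) (fun y hy => h01 j y (hsub d hd hy))
      (hM _ (mem_range_self j)) x ?_
    rw [mem_ball] at hx ⊢
    linarith [dist_triangle x z d, dist_comm z d]
  · right
    refine ⟨R / 8, by positivity, fun M => ?_⟩
    obtain ⟨C, hC⟩ := exists_bound_of_omits_zero_one M (E := E)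
    filter_upwards [hinf.eventually_gt_atTop C] with j hj x hx
    by_contra! hle
    refine hj.not_ge (hC (g j) x (R / 2) ((hg j).mono (hsub x hx))
      (fun y hy => h01 j y (hsub x hx hy)) hle d ?_)
    rw [mem_ball] at hx ⊢
    linarith [dist_triangle d z x, dist_comm z x]

/-- **Montel's fundamental normality test** in several variables: a sequence of holomorphic
functions omitting the values `0` and `1` has a subsequence that, on every connected component,
converges or diverges uniformly on compact sets. -/
theorem exists_subseq_of_omits_zero_one [ProperSpace E] {g : ℕ → E → ℂ} {Ω : Set E}
    (hΩ : IsOpen Ω) (hg : ∀ j, DifferentiableOn ℂ (g j) Ω)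
    (h01 : ∀ j, ∀ z ∈ Ω, g j z ≠ 0 ∧ g j z ≠ 1) :
    ∃ φ : ℕ → ℕ, StrictMono φ ∧ ∀ z ∈ Ω,
      (∃ G : E → ℂ, DifferentiableOn ℂ G (connectedComponentIn Ω z) ∧
        ∀ K ⊆ connectedComponentIn Ω z, IsCompact K →
          TendstoUniformlyOn (fun j => g (φ j)) G atTop K) ∨
      ∀ K ⊆ connectedComponentIn Ω z, IsCompact K → ∀ M : ℝ,
        ∀ᶠ j in atTop, ∀ x ∈ K, M < ‖g (φ j) x‖ := by
  obtain ⟨D, hDc, hD⟩ := TopologicalSpace.exists_countable_dense E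
  have := hDc.to_subtype
  obtain ⟨φ, hφ, hlim⟩ := exists_subseq_tendsto_or_tendsto_norm_atTop (D := D) (fun j d => g j d)
  refine ⟨φ, hφ, fun z hz => ?_⟩
  set V := connectedComponentIn Ω z
  have : LocallyConnectedSpace E :=
    let : NormedSpace ℝ E := NormedSpace.restrictScalars ℝ ℂ E
    inferInstance
  have hV : IsOpen V := hΩ.connectedComponentIn
  have hVΩ : V ⊆ Ω := connectedComponentIn_subset Ω z
  set A : Set E := {x | ∃ r > 0, ∃ M, ∀ j, ∀ y ∈ ball x r, ‖g (φ j) y‖ ≤ M}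
  set B : Set E := {x | ∃ r > 0, ∀ M, ∀ᶠ j in atTop, ∀ y ∈ ball x r, M < ‖g (φ j) y‖}
  have hball : ∀ {x y : E} {r : ℝ}, y ∈ ball x (r / 2) → ball y (r / 2) ⊆ ball x r :=
    fun hy => ball_subset_ball' (by rw [mem_ball] at hy; linarith)
  have hAo : IsOpen A := by
    rw [Metric.isOpen_iff]
    rintro x ⟨r, hr, M, hM⟩
    exact ⟨r / 2, half_pos hr, fun y hy => ⟨r / 2, half_pos hr, M,
      fun j w hw => hM j w (hball hy hw)⟩⟩
  have hBo : IsOpen B := by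
    rw [Metric.isOpen_iff]
    rintro x ⟨r, hr, hM⟩
    exact ⟨r / 2, half_pos hr, fun y hy => ⟨r / 2, half_pos hr,
      fun M => (hM M).mono fun j hj w hw => hj w (hball hy hw)⟩⟩
  have hdisj : Disjoint A B := by
    rw [Set.disjoint_left]
    rintro x ⟨r, hr, M, hM⟩ ⟨s, hs, hdiv⟩
    obtain ⟨j, hj⟩ := (hdiv M).exists
    exact (hj x (mem_ball_self hs)).not_ge (hM j x (mem_ball_self hr))
  have hcover : V ⊆ A ∪ B := fun x hx =>
    locally_bounded_or_locally_divergent hΩ hD (fun j => hg (φ j)) (fun j => h01 (φ j))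
      (fun d hd => hlim ⟨d, hd⟩) (hVΩ hx)
  rcases isPreconnected_connectedComponentIn.subset_or_subset hAo hBo hdisj hcover with hVA | hVB
  · left
    refine exists_differentiableOn_tendstoUniformlyOn hV hD (fun j => (hg (φ j)).mono hVΩ)
      (fun x hx => hVA hx) ?_
    rintro d ⟨hdD, hdV⟩
    obtain ⟨r, hr, M, hM⟩ := hVA hdV
    refine (hlim ⟨d, hdD⟩).resolve_right fun hinf => ?_
    obtain ⟨j, hj⟩ := (hinf.eventually_gt_atTop M).exists
    exact hj.not_ge (hM j d (mem_ball_self hr))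
  · right
    exact fun K hKV hK M => eventually_lt_norm_of_isCompact hK (fun x hx => hVB (hKV hx)) M

end

/-! ### Functions avoiding two holomorphic functions -/

theorem mainTheorem4 {n : ℕ} (Ω : Set (EuclideanSpace ℂ (Fin n))) (hΩ : IsOpen Ω)
    (a b : EuclideanSpace ℂ (Fin n) → ℂ)
    (ha : DifferentiableOn ℂ a Ω) (hb : DifferentiableOn ℂ b Ω)
    (hab : ∀ z ∈ Ω, a z ≠ b z)
    (F : Set (EuclideanSpace ℂ (Fin n) → ℂ))
    (hF : ∀ f ∈ F, DifferentiableOn ℂ f Ω)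
    (hFab : ∀ f ∈ F, ∀ z ∈ Ω, f z ≠ a z ∧ f z ≠ b z) :
    IsNormalFamilyOn F Ω := by
  intro f hf
  have hne : ∀ z ∈ Ω, b z - a z ≠ 0 := fun z hz => sub_ne_zero.2 (hab z hz).symm
  set g : ℕ → EuclideanSpace ℂ (Fin n) → ℂ := fun j z => (f j z - a z) / (b z - a z) with hgdef
  have hfg : ∀ j, ∀ z ∈ Ω, f j z = a z + (b z - a z) * g j z := fun j z hz => by
    rw [hgdef]
    have := hne z hz
    field_simp
    ring
  obtain ⟨φ, hφ, hlim⟩ := exists_subseq_of_omits_zero_one hΩ (g := g)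
    (fun j => by
      simp only [hgdef, div_eq_mul_inv]
      exact ((hF _ (hf j)).sub ha).mul ((hb.sub ha).inv hne))
    (fun j z hz => ⟨div_ne_zero (sub_ne_zero.2 (hFab _ (hf j) z hz).1) (hne z hz), fun h =>
      (hFab _ (hf j) z hz).2 (by rw [hfg j z hz, h]; ring)⟩)
  refine ⟨φ, hφ, fun z hz => ?_⟩
  have hVΩ := connectedComponentIn_subset Ω z
  rcases hlim z hz with ⟨G, hGd, hG⟩ | hdiv
  · left
    refine ⟨fun x => a x + (b x - a x) * G x,
      (ha.mono hVΩ).add (((hb.sub ha).mono hVΩ).mul hGd), fun K hKV hK => ?_⟩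
    obtain ⟨B, hB⟩ := hK.exists_bound_of_continuousOn
      ((hb.sub ha).continuousOn.mono (hKV.trans hVΩ))
    rw [Metric.tendstoUniformlyOn_iff]
    intro ε hε
    filter_upwards [Metric.tendstoUniformlyOn_iff.1 (hG K hKV hK) (ε / (|B| + 1))
      (by positivity)] with j hj x hx
    have h1 := hj x hx
    rw [dist_eq_norm, lt_div_iff₀ (by positivity)] at h1
    have e : a x + (b x - a x) * G x - (a x + (b x - a x) * g (φ j) x)
        = (b x - a x) * (G x - g (φ j) x) := by ring
    rw [hfg _ x (hVΩ (hKV hx)), dist_eq_norm, e, norm_mul]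
    have h2 : ‖b x - a x‖ ≤ |B| + 1 := (hB x hx).trans ((le_abs_self B).trans (by linarith))
    nlinarith [norm_nonneg (G x - g (φ j) x)]
  · right
    intro K hKV hK R
    have hKΩ := hKV.trans hVΩ
    obtain ⟨A, hA⟩ := hK.exists_bound_of_continuousOn (ha.continuousOn.mono hKΩ)
    -- `b - a` is bounded away from `0` on `K`, because its inverse is bounded.
    obtain ⟨B, hB⟩ := hK.exists_bound_of_continuousOn (f := fun x => (b x - a x)⁻¹)
      (((hb.sub ha).continuousOn.mono hKΩ).inv₀ fun x hx => hne x (hKΩ hx))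
    filter_upwards [hdiv K hKV hK (B * (R + A))] with j hj x hx
    by_contra! hle
    refine (hj x hx).not_ge ?_
    have h1 : ‖f (φ j) x - a x‖ ≤ R + A := (norm_sub_le _ _).trans (add_le_add hle (hA x hx))
    rw [hgdef]
    simp only [div_eq_inv_mul, norm_mul]
    exact mul_le_mul (hB x hx) h1 (norm_nonneg _) ((norm_nonneg _).trans (hB x hx))
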